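/- Let $n\ge 1$ be an integer, let $0<s<n$, $1\le p<\frac ns$ and $1\le q<\frac{np}{n-sp}$ be real numbers, and let $\Omega\subset\mathbb R^n$ be a bounded open set with smooth boundary (near each boundary point, $\Omega$ is the set $\{\rho<0\}$ for some $C^\infty$ function $\rho$ whose differential does not vanish at that point). For a tempered distribution $u$ on $\mathbb R^n$ put $$(1-\Delta)^{s/2}u:=\mathcal F^{-1}\bigl((1+|\xi|^2)^{s/2}\,\mathcal F u\bigr),\qquad \mathcal F f(\xi)=\int_{\mathbb R^n}f(x)e^{-ix\cdot\xi}\,dx .$$ Let $(u_m)_{m\in\mathbb N}$ be a sequence of complex-valued functions in $L^q(\mathbb R^n)$ such that every $(1-\Delta)^{s/2}u_m$ belongs to $L^p(\mathbb R^n)$ and $$\sup_m\int_{\mathbb R^n}\bigl|(1-\Delta)^{s/2}u_m(x)\bigr|^p\,dx<\infty .$$ Then there are a subsequence $(u_{m_k})_k$ and a function $v\in L^q(\Omega)$ such that $\|u_{m_k}-v\|_{L^q(\Omega)}\to 0$ as $k\to\infty$. -/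

import Mathlib

open MeasureTheory TemperedDistribution Filter Topology
open scoped SchwartzMap ENNReal ContDiff

/-- The symbol of `(1 - Δ)^{s/2}`. With the Fourier transform `∫ f(x) e^{-i x·ξ} dx` it is
`(1 + |ξ|²)^{s/2}`; Mathlib's Fourier transform is `∫ f(x) e^{-2πi x·ξ} dx`, for which the
variable `ξ` has to be replaced by `2πξ`. -/
noncomputable def besselSymbol (n : ℕ) (s : ℝ) (ξ : EuclideanSpace ℝ (Fin n)) : ℝ :=
  (1 + (2 * Real.pi * ‖ξ‖) ^ 2) ^ (s / 2)

/-- The symbol is smooth of temperate growth, so that multiplication by it is a genuine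
operation on tempered distributions. -/
theorem besselSymbol_hasTemperateGrowth (n : ℕ) (s : ℝ) :
    Function.HasTemperateGrowth (fun ξ ↦ (besselSymbol n s ξ : ℂ)) := by
  have h := Function.hasTemperateGrowth_one_add_norm_sq_rpow (EuclideanSpace ℝ (Fin n)) (s / 2)
  have h2 : Function.HasTemperateGrowth
      (fun ξ : EuclideanSpace ℝ (Fin n) ↦ (2 * Real.pi) • ξ) := by fun_prop
  have h3 := h.comp h2
  have h4 : besselSymbol n s = (fun ξ : EuclideanSpace ℝ (Fin n) ↦
      (1 + ‖(2 * Real.pi) • ξ‖ ^ 2) ^ (s / 2)) := by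
    funext ξ
    rw [besselSymbol, norm_smul, Real.norm_eq_abs, abs_of_pos (by positivity)]
  rw [h4]
  have h5 : Function.HasTemperateGrowth (fun ξ : EuclideanSpace ℝ (Fin n) ↦
      (1 + ‖(2 * Real.pi) • ξ‖ ^ 2) ^ (s / 2)) := h3
  fun_prop

/-- The operator `(1 - Δ)^{s/2}` (that is, `√(1 - Δ)` to the power `s`) on tempered
distributions on `ℝⁿ`: the Fourier multiplier `u ↦ 𝓕⁻¹ ((1 + |ξ|²)^{s/2} 𝓕 u)`. -/
noncomputable def besselOp (n : ℕ) (s : ℝ) :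
    𝓢'(EuclideanSpace ℝ (Fin n), ℂ) →L[ℂ] 𝓢'(EuclideanSpace ℝ (Fin n), ℂ) :=
  fourierMultiplierCLM ℂ (fun ξ ↦ (besselSymbol n s ξ : ℂ))

/-- `Ω` has a smooth boundary: near each boundary point, `Ω` is the set where a `C^∞` function
with non-vanishing differential is negative. -/
def HasSmoothBoundary {n : ℕ} (Ω : Set (EuclideanSpace ℝ (Fin n))) : Prop :=
  ∀ x ∈ frontier Ω, ∃ U : Set (EuclideanSpace ℝ (Fin n)), IsOpen U ∧ x ∈ U ∧
    ∃ ρ : EuclideanSpace ℝ (Fin n) → ℝ,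
      ContDiffOn ℝ ∞ ρ U ∧ fderiv ℝ ρ x ≠ 0 ∧ Ω ∩ U = {y ∈ U | ρ y < 0}

/-!
The operator `(1 - Δ)^{s/2}` is inverted by convolution with the Bessel kernel `G_s`, and
convolution with a kernel in `L^r` is a compact operator from `L^p(ℝⁿ)` to `L^{q₁}(Ω)`, for bounded
`Ω` and `1/p + 1/r = 1 + 1/q₁`.

The kernel is the subordinated heat kernel
`G_s(x) = Γ(s/2)⁻¹ ∫₀^∞ t^{s/2-1} e^{-t} (4πt)^{-n/2} e^{-|x|²/4t} dt`. Since the Fourier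
transform of the heat kernel is a Gaussian, the Gamma integral gives `𝓕 G_s = (1 + 4π²|ξ|²)^{-s/2}`
(`fourier_besselKernel`), and Jensen's inequality in `t` followed by Tonelli shows that `G_s` is in
`L^r` whenever `r (n - s) < n` (`memLp_besselKernel`). By duality with test functions,
`(1 - Δ)^{s/2} u = f` forces `u = G_s * f` almost everywhere (`ae_eq_besselKernel_convolution`).

For compactness (`exists_subseq_tendsto_convolution`), the kernel is approximated in `L^r` by
continuous compactly supported ones. Young's inequality (`eLpNorm_lconvolution_le`) makes the error
small in `L^{q₁}` uniformly on bounded subsets of `L^p`, and for the approximating kernels the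
convolutions are bounded and equicontinuous on the closure of `Ω`, so that the Arzelà–Ascoli theorem
applies. The images thus form a totally bounded set in the complete space `L^{q₁}(Ω)`.

The exponents are `q₁ = max(p, q)`, which is still below `np/(n - sp)`, and the `r` determined by
Young's relation; the subcriticality of `q₁` is exactly `r (n - s) < n`. As `Ω` has finite measure,
convergence in `L^{q₁}(Ω)` implies convergence in `L^q(Ω)`.
-/

/-! ### Young's convolution inequality -/

/-- **Young's convolution inequality** for nonnegative functions, in the form raised to the
power `q`. -/
theorem lintegral_lconvolution_rpow_le {V : Type*} [AddCommGroup V] [MeasurableSpace V]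
    [MeasurableAdd₂ V] [MeasurableNeg V] {μ : Measure V} [SFinite μ] [μ.IsAddLeftInvariant]
    [μ.IsNegInvariant] {p q r : ℝ} (hp : 1 ≤ p) (hq : 0 < q) (hr : 1 ≤ r)
    (hpqr : 1 / p + 1 / r = 1 + 1 / q) {f g : V → ℝ≥0∞} (hf : Measurable f) (hg : Measurable g) :
    ∫⁻ x, (∫⁻ y, g (x - y) * f y ∂μ) ^ q ∂μ ≤
      (∫⁻ x, g x ^ r ∂μ) ^ (q / r) * (∫⁻ x, f x ^ p ∂μ) ^ (q / p) := by
  have hp0 : 0 < p := by linarith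
  have hr0 : 0 < r := by linarith
  set A := ∫⁻ x, g x ^ r ∂μ
  set B := ∫⁻ x, f x ^ p ∂μ
  have hp1 : 1 / p ≤ 1 := by rw [div_le_one hp0]; exact hp
  have hr1 : 1 / r ≤ 1 := by rw [div_le_one hr0]; exact hr
  have ha : 0 ≤ 1 / r - 1 / q := by linarith
  have hb : 0 ≤ 1 / p - 1 / q := by linarith
  have hc : 0 ≤ 1 / q := by positivity
  have hqa : q * (1 / r - 1 / q) = q / r - 1 := by field_simp
  have hqb : q * (1 / p - 1 / q) = q / p - 1 := by field_simp
  have hqa0 : 0 ≤ q / r - 1 := hqa ▸ mul_nonneg hq.le ha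
  have hqb0 : 0 ≤ q / p - 1 := hqb ▸ mul_nonneg hq.le hb
  have key : ∀ x, (∫⁻ y, g (x - y) * f y ∂μ) ^ q ≤
      (∫⁻ y, g (x - y) ^ r * f y ^ p ∂μ) * (A ^ (q / r - 1) * B ^ (q / p - 1)) := by
    intro x
    have hgx : Measurable fun y ↦ g (x - y) := hg.comp (measurable_const.sub measurable_id)
    -- Hölder's inequality for the factorization
    -- `g f = (g^r f^p)^{1/q} (g^r)^{1/r - 1/q} (f^p)^{1/p - 1/q}`; the exponents add up to `1`
    have hol := ENNReal.lintegral_prod_norm_pow_le (μ := μ) (Finset.univ : Finset (Fin 3))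
      (f := ![fun y ↦ g (x - y) ^ r * f y ^ p, fun y ↦ g (x - y) ^ r, fun y ↦ f y ^ p])
      (p := ![1 / q, 1 / r - 1 / q, 1 / p - 1 / q])
      (by
        intro i _
        fin_cases i
        · exact ((hgx.pow_const r).mul (hf.pow_const p)).aemeasurable
        · exact (hgx.pow_const r).aemeasurable
        · exact (hf.pow_const p).aemeasurable)
      (by simp only [Fin.sum_univ_three, Matrix.cons_val]; linarith)
      (by intro i _; fin_cases i <;> assumption)
    simp only [Fin.prod_univ_three, Matrix.cons_val] at hol
    have e1 : ∀ y, (g (x - y) ^ r * f y ^ p) ^ (1 / q) * (g (x - y) ^ r) ^ (1 / r - 1 / q) *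
        (f y ^ p) ^ (1 / p - 1 / q) = g (x - y) * f y := by
      intro y
      rw [ENNReal.mul_rpow_of_nonneg _ _ hc]
      have h1 : (g (x - y) ^ r) ^ (1 / q) * (g (x - y) ^ r) ^ (1 / r - 1 / q) = g (x - y) := by
        rw [← ENNReal.rpow_add_of_nonneg _ _ hc ha, ← ENNReal.rpow_mul]
        have : r * (1 / q + (1 / r - 1 / q)) = 1 := by field_simp; ring
        rw [this, ENNReal.rpow_one]
      have h2 : (f y ^ p) ^ (1 / q) * (f y ^ p) ^ (1 / p - 1 / q) = f y := by
        rw [← ENNReal.rpow_add_of_nonneg _ _ hc hb, ← ENNReal.rpow_mul]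
        have : p * (1 / q + (1 / p - 1 / q)) = 1 := by field_simp; ring
        rw [this, ENNReal.rpow_one]
      calc _ = ((g (x - y) ^ r) ^ (1 / q) * (g (x - y) ^ r) ^ (1 / r - 1 / q)) *
            ((f y ^ p) ^ (1 / q) * (f y ^ p) ^ (1 / p - 1 / q)) := by ring
        _ = _ := by rw [h1, h2]
    simp only [e1] at hol
    have hA : ∫⁻ y, g (x - y) ^ r ∂μ = A :=
      lintegral_sub_left_eq_self (fun y ↦ g y ^ r) x
    rw [hA] at hol
    calc (∫⁻ y, g (x - y) * f y ∂μ) ^ q ≤ _ := ENNReal.rpow_le_rpow hol hq.le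
      _ = _ := by
        rw [ENNReal.mul_rpow_of_nonneg _ _ hq.le, ENNReal.mul_rpow_of_nonneg _ _ hq.le,
          ← ENNReal.rpow_mul, ← ENNReal.rpow_mul, ← ENNReal.rpow_mul, one_div_mul_cancel hq.ne',
          mul_comm _ q, mul_comm _ q, hqa, hqb, ENNReal.rpow_one, mul_assoc]
  have hm : Measurable fun z : V × V ↦ g (z.1 - z.2) ^ r * f z.2 ^ p := by fun_prop
  calc ∫⁻ x, (∫⁻ y, g (x - y) * f y ∂μ) ^ q ∂μ
      ≤ ∫⁻ x, (∫⁻ y, g (x - y) ^ r * f y ^ p ∂μ) * (A ^ (q / r - 1) * B ^ (q / p - 1)) ∂μ :=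
        lintegral_mono key
    _ = (∫⁻ x, ∫⁻ y, g (x - y) ^ r * f y ^ p ∂μ ∂μ) * (A ^ (q / r - 1) * B ^ (q / p - 1)) :=
        lintegral_mul_const _ hm.lintegral_prod_right'
    _ = (A * B) * (A ^ (q / r - 1) * B ^ (q / p - 1)) := by
        rw [lintegral_lintegral_swap hm.aemeasurable]
        have : ∀ y, ∫⁻ x, g (x - y) ^ r * f y ^ p ∂μ = A * f y ^ p := by
          intro y
          rw [lintegral_mul_const _ (by fun_prop), lintegral_sub_right_eq_self (fun y ↦ g y ^ r) y]
        simp_rw [this]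
        rw [lintegral_const_mul _ (hf.pow_const p)]
    _ = (A * A ^ (q / r - 1)) * (B * B ^ (q / p - 1)) := by ring
    _ = A ^ (q / r) * B ^ (q / p) := by
        have h (X : ℝ≥0∞) (e : ℝ) (he : 0 ≤ e - 1) : X * X ^ (e - 1) = X ^ e := by
          conv_lhs => enter [1]; rw [← ENNReal.rpow_one X]
          rw [← ENNReal.rpow_add_of_nonneg _ _ zero_le_one he, add_sub_cancel]
        rw [h A _ hqa0, h B _ hqb0]

/-- **Young's convolution inequality** for the convolution of the absolute values of two
functions. It also bounds the convolution itself, and contains its absolute convergence at almost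
every point. -/
theorem eLpNorm_lconvolution_le {V : Type*} [AddCommGroup V] [MeasurableSpace V]
    [MeasurableAdd₂ V] [MeasurableNeg V] {μ : Measure V} [SFinite μ] [μ.IsAddLeftInvariant]
    [μ.IsNegInvariant] {p q r : ℝ} (hp : 1 ≤ p) (hq : 0 < q) (hr : 1 ≤ r)
    (hpqr : 1 / p + 1 / r = 1 + 1 / q) {f g : V → ℂ} (hf : Measurable f) (hg : Measurable g) :
    eLpNorm (fun x ↦ ∫⁻ y, ‖g (x - y)‖ₑ * ‖f y‖ₑ ∂μ) (ENNReal.ofReal q) μ ≤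
      eLpNorm g (ENNReal.ofReal r) μ * eLpNorm f (ENNReal.ofReal p) μ := by
  have hp0 : 0 < p := by linarith
  have hr0 : 0 < r := by linarith
  rw [eLpNorm_eq_lintegral_rpow_enorm_toReal (by simpa using hq) ENNReal.ofReal_ne_top,
    eLpNorm_eq_lintegral_rpow_enorm_toReal (by simpa using hr0) ENNReal.ofReal_ne_top,
    eLpNorm_eq_lintegral_rpow_enorm_toReal (by simpa using hp0) ENNReal.ofReal_ne_top,
    ENNReal.toReal_ofReal hq.le, ENNReal.toReal_ofReal hp0.le, ENNReal.toReal_ofReal hr0.le]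
  have := lintegral_lconvolution_rpow_le (μ := μ) hp hq hr hpqr hf.enorm hg.enorm
  have := ENNReal.rpow_le_rpow this (z := 1 / q) (by positivity)
  rw [ENNReal.mul_rpow_of_nonneg _ _ (by positivity), ← ENNReal.rpow_mul,
    ← ENNReal.rpow_mul] at this
  have e1 : q / r * (1 / q) = 1 / r := by field_simp
  have e2 : q / p * (1 / q) = 1 / p := by field_simp
  rw [e1, e2] at this
  simpa using this

/-! ### The Bessel potential kernel -/

section BesselKernel

open Real Set Module

variable {V : Type*} [NormedAddCommGroup V] [InnerProductSpace ℝ V]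

/-- The integrand of the Bessel kernel on `V`, at time `t > 0`: the density
`Γ(s/2)⁻¹ t^{s/2-1} e^{-t}` of the Gamma distribution times the heat kernel
`(4πt)^{-d/2} e^{-|x|²/4t}`, where `d = dim V`. Only the values at `t > 0` are meaningful. -/
noncomputable def besselDensity (s : ℝ) (t : ℝ) (x : V) : ℝ :=
  (Gamma (s / 2))⁻¹ * (t ^ (s / 2 - 1) * exp (-t)) *
    ((4 * π * t) ^ (-(finrank ℝ V / 2 : ℝ)) * exp (-(4 * t)⁻¹ * ‖x‖ ^ 2))

/-- The kernel of `(1 - Δ)^{-s/2}` on `V`, as the superposition of heat kernels with Gamma weights.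
For `0 < s` the integral converges at almost every point (`x = 0` is the exception if `s ≤ dim V`),
and where it diverges the kernel has the value `0`. -/
noncomputable def besselKernel (s : ℝ) (x : V) : ℝ := ∫ t in Ioi 0, besselDensity s t x

theorem besselDensity_nonneg {s t : ℝ} (hs : 0 < s) (ht : 0 < t) (x : V) :
    0 ≤ besselDensity s t x := by
  have := Gamma_pos_of_pos (half_pos hs)
  unfold besselDensity
  positivity

/-- The integrand produced by Jensen's inequality for the weight `t^{c-1} e^{-t}`: the powers of
`e^{-t}` combine to `e^{-t}` again. -/
theorem besselDensity_weighted_rpow {s t r c : ℝ} (hs : 0 < s) (ht : 0 < t) (x : V) :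
    (t ^ (c - 1) * exp (-t)) ^ (1 - r) * besselDensity s t x ^ r =
      ((Gamma (s / 2))⁻¹ ^ r * (4 * π) ^ (-(finrank ℝ V / 2 : ℝ) * r)) *
        (exp (-t) * t ^ ((c - 1) * (1 - r) + (s / 2 - 1) * r - finrank ℝ V / 2 * r)) *
        exp (-(r * (4 * t)⁻¹) * ‖x‖ ^ 2) := by
  have hG := Gamma_pos_of_pos (half_pos hs)
  unfold besselDensity
  rw [mul_rpow (by positivity) (by positivity), mul_rpow (by positivity) (by positivity),
    mul_rpow (by positivity) (by positivity), mul_rpow (by positivity) (by positivity),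
    mul_rpow (by positivity) (by positivity), mul_rpow (by positivity) (by positivity),
    mul_rpow (by positivity) (by positivity), ← rpow_mul ht.le, ← rpow_mul ht.le, ← rpow_mul ht.le,
    ← rpow_mul (by positivity), ← exp_mul, ← exp_mul, ← exp_mul, sub_eq_add_neg _ (_ / 2 * r),
    rpow_add ht, rpow_add ht]
  have e1 : exp (-t) = exp (-t * (1 - r)) * exp (-t * r) := by rw [← exp_add]; ring_nf
  rw [e1, neg_mul (_ / 2) r]
  ring_nf

theorem enorm_besselKernel_le {s : ℝ} (hs : 0 < s) (x : V) :
    ‖besselKernel s x‖ₑ ≤ ∫⁻ t in Ioi 0, ENNReal.ofReal (besselDensity s t x) := by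
  refine (enorm_integral_le_lintegral_enorm _).trans_eq ?_
  refine setLIntegral_congr_fun measurableSet_Ioi fun t ht ↦ ?_
  exact Real.enorm_of_nonneg (besselDensity_nonneg hs ht x)

variable [MeasurableSpace V] [BorelSpace V]

theorem measurable_besselDensity (s : ℝ) :
    Measurable fun z : V × ℝ ↦ besselDensity s z.2 z.1 := by
  unfold besselDensity
  fun_prop

theorem measurable_besselKernel (s : ℝ) : Measurable (besselKernel s : V → ℝ) :=
  (StronglyMeasurable.integral_prod_right'
    (ν := volume.restrict (Ioi (0 : ℝ))) (measurable_besselDensity s).stronglyMeasurable).measurable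

variable [FiniteDimensional ℝ V]

theorem lintegral_exp_neg_mul_sq_norm {b : ℝ} (hb : 0 < b) :
    ∫⁻ x : V, ENNReal.ofReal (exp (-b * ‖x‖ ^ 2)) =
      ENNReal.ofReal ((π / b) ^ (finrank ℝ V / 2 : ℝ)) := by
  rw [← GaussianFourier.integral_rexp_neg_mul_sq_norm hb, ofReal_integral_eq_lintegral_ofReal]
  · by_contra h
    have := GaussianFourier.integral_rexp_neg_mul_sq_norm (V := V) hb
    rw [integral_undef h] at this
    have : 0 < (π / b) ^ (finrank ℝ V / 2 : ℝ) := by positivity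
    linarith
  · exact ae_of_all _ fun x ↦ (exp_pos _).le

/-- The `L^r` bound behind `memLp_besselKernel`. The condition on `r` is the subcriticality
`r < d / (d - s)`, written so as to make sense for `d ≤ s` too. -/
theorem lintegral_besselDensity_rpow_lt_top {s r : ℝ} (hs : 0 < s) (hr : 1 ≤ r)
    (hrs : r * (finrank ℝ V - s) < finrank ℝ V) :
    ∫⁻ x : V, (∫⁻ t in Ioi 0, ENNReal.ofReal (besselDensity s t x)) ^ r < (⊤ : ℝ≥0∞) := by
  have hr0 : 0 < r := by linarith
  set d : ℝ := (finrank ℝ V : ℝ) with hd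
  -- `c` is chosen so that the exponent of `t` left after integrating in `x` is again `c - 1`
  set δ : ℝ := (d - r * (d - s)) / 2
  have hδ : 0 < δ := by simp only [δ]; linarith
  set c : ℝ := δ / r with hcdef
  have hc : 0 < c := by positivity
  have he : (c - 1) * (1 - r) + (s / 2 - 1) * r - d / 2 * r + d / 2 = c - 1 := by
    have : c * r = δ := by rw [hcdef]; field_simp
    have h2 : (c - 1) * (1 - r) + (s / 2 - 1) * r - d / 2 * r + d / 2 =
      c - 1 - c * r + (d - r * (d - s)) / 2 := by ring
    rw [h2, this]; simp only [δ]; ring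
  set w : ℝ → ℝ := fun t ↦ t ^ (c - 1) * exp (-t)
  have hwint : IntegrableOn w (Ioi 0) := by
    simpa only [w, mul_comm] using GammaIntegral_convergent hc
  have hw0 : ∀ t ∈ Ioi (0 : ℝ), 0 < w t := fun t ht ↦
    mul_pos (rpow_pos_of_pos ht _) (exp_pos _)
  have hwm : Measurable w := by fun_prop
  have hW : ∫⁻ t in Ioi 0, ENNReal.ofReal (w t) < ⊤ := hwint.lintegral_lt_top
  set W := ∫⁻ t in Ioi 0, ENNReal.ofReal (w t)
  have hKm : Measurable fun z : V × ℝ ↦ besselDensity s z.2 z.1 := measurable_besselDensity s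
  have hr1 : 1 / r ≤ 1 := by rw [div_le_one hr0]; exact hr
  -- Jensen's inequality in `t`, for the finite measure with density `w`
  have key : ∀ x : V, (∫⁻ t in Ioi 0, ENNReal.ofReal (besselDensity s t x)) ^ r ≤
      W ^ (r - 1) *
        ∫⁻ t in Ioi 0, ENNReal.ofReal (w t ^ (1 - r) * besselDensity s t x ^ r) := by
    intro x
    have hKx : Measurable fun t ↦ besselDensity s t x :=
      hKm.comp (by fun_prop : Measurable (Prod.mk x))
    have hol := ENNReal.lintegral_mul_norm_pow_le (μ := volume.restrict (Ioi (0 : ℝ)))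
      (f := fun t ↦ ENNReal.ofReal (w t))
      (g := fun t ↦ ENNReal.ofReal (w t ^ (1 - r) * besselDensity s t x ^ r))
      (by fun_prop) (by fun_prop) (p := 1 - 1 / r) (q := 1 / r) (by linarith) (by positivity)
      (by ring)
    have heq : ∫⁻ t in Ioi 0, ENNReal.ofReal (besselDensity s t x) =
        ∫⁻ t in Ioi 0, ENNReal.ofReal (w t) ^ (1 - 1 / r) *
          ENNReal.ofReal (w t ^ (1 - r) * besselDensity s t x ^ r) ^ (1 / r) := by
      refine setLIntegral_congr_fun measurableSet_Ioi fun t ht ↦ ?_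
      have hw := hw0 t ht
      have hK := besselDensity_nonneg hs ht x
      rw [ENNReal.ofReal_rpow_of_pos hw, ENNReal.ofReal_rpow_of_nonneg (by positivity)
        (by positivity), ← ENNReal.ofReal_mul (by positivity),
        mul_rpow (rpow_nonneg hw.le _) (rpow_nonneg hK _), ← rpow_mul hw.le, ← rpow_mul hK,
        ← mul_assoc, ← rpow_add hw]
      have e1 : 1 - 1 / r + (1 - r) * (1 / r) = 0 := by field_simp; ring
      have e2 : r * (1 / r) = 1 := by field_simp
      rw [e1, e2, rpow_zero, rpow_one, one_mul]
    rw [heq]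
    refine (ENNReal.rpow_le_rpow hol hr0.le).trans_eq ?_
    rw [ENNReal.mul_rpow_of_nonneg _ _ hr0.le, ← ENNReal.rpow_mul, ← ENNReal.rpow_mul]
    have e1 : (1 - 1 / r) * r = r - 1 := by field_simp
    have e2 : 1 / r * r = 1 := by field_simp
    rw [e1, e2, ENNReal.rpow_one]
  refine (lintegral_mono key).trans_lt ?_
  rw [lintegral_const_mul' _ _ (ENNReal.rpow_ne_top_of_nonneg (by linarith) hW.ne)]
  refine ENNReal.mul_lt_top (ENNReal.rpow_lt_top_of_nonneg (by linarith) hW.ne) ?_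
  -- after Tonelli, the inner integral is Gaussian and the outer one is a multiple of that of `w`
  rw [lintegral_lintegral_swap (by fun_prop)]
  set C : ℝ := ((Gamma (s / 2))⁻¹ ^ r * (4 * π) ^ (-(d / 2 : ℝ) * r)) * (4 * π / r) ^ (d / 2)
  have hG := Gamma_pos_of_pos (half_pos hs)
  have hin : ∀ t ∈ Ioi (0 : ℝ), ∫⁻ x : V,
      ENNReal.ofReal (w t ^ (1 - r) * besselDensity s t x ^ r) = ENNReal.ofReal (C * w t) := by
    intro t ht
    have ht' : 0 < t := ht
    simp only [w, besselDensity_weighted_rpow hs ht']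
    rw [← hd]
    simp_rw [ENNReal.ofReal_mul' (exp_pos _).le]
    rw [lintegral_const_mul _ (by fun_prop), lintegral_exp_neg_mul_sq_norm (by positivity),
      ← ENNReal.ofReal_mul' (by positivity)]
    have e1 : π / (r * (4 * t)⁻¹) = 4 * π / r * t := by field_simp
    have e2 : t ^ (c - 1) =
        t ^ ((c - 1) * (1 - r) + (s / 2 - 1) * r - d / 2 * r) * t ^ (d / 2) := by
      rw [← rpow_add ht', he]
    rw [e1, mul_rpow (by positivity) ht'.le, e2, ← hd]
    simp only [C]
    ring_nf
  rw [setLIntegral_congr_fun measurableSet_Ioi hin]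
  exact (hwint.const_mul C).lintegral_lt_top

theorem memLp_besselKernel {s r : ℝ} (hs : 0 < s) (hr : 1 ≤ r)
    (hrs : r * (finrank ℝ V - s) < finrank ℝ V) :
    MemLp (fun x : V ↦ (besselKernel s x : ℂ)) (ENNReal.ofReal r) := by
  have hr0 : 0 < r := by linarith
  refine ⟨(Complex.measurable_ofReal.comp (measurable_besselKernel s)).aestronglyMeasurable, ?_⟩
  rw [eLpNorm_lt_top_iff_lintegral_rpow_enorm_lt_top (by simpa using hr0) ENNReal.ofReal_ne_top,
    ENNReal.toReal_ofReal hr0.le]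
  refine (lintegral_mono fun x ↦ ?_).trans_lt (lintegral_besselDensity_rpow_lt_top hs hr hrs)
  refine ENNReal.rpow_le_rpow ?_ hr0.le
  simpa [enorm_eq_nnnorm] using enorm_besselKernel_le hs x

theorem integrable_besselKernel {s : ℝ} (hs : 0 < s) :
    Integrable (fun x : V ↦ (besselKernel s x : ℂ)) := by
  rw [← memLp_one_iff_integrable]
  simpa using memLp_besselKernel (V := V) hs le_rfl (by linarith)

theorem integrable_besselDensity {s : ℝ} (hs : 0 < s) :
    Integrable (fun z : V × ℝ ↦ besselDensity s z.2 z.1)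
      (volume.prod (volume.restrict (Ioi 0))) := by
  refine ⟨(measurable_besselDensity s).aestronglyMeasurable, ?_⟩
  have := lintegral_besselDensity_rpow_lt_top (V := V) hs le_rfl (by linarith)
  simp only [ENNReal.rpow_one] at this
  rw [hasFiniteIntegral_iff_enorm, lintegral_prod _ (by
    exact (measurable_besselDensity s).enorm.aemeasurable)]
  refine (lintegral_mono fun x ↦ le_of_eq ?_).trans_lt this
  refine setLIntegral_congr_fun measurableSet_Ioi fun t ht ↦ ?_
  exact Real.enorm_of_nonneg (besselDensity_nonneg hs ht x)

open FourierTransform in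
theorem fourier_besselKernel {s : ℝ} (hs : 0 < s) (ξ : V) :
    𝓕 (fun x : V ↦ (besselKernel s x : ℂ)) ξ =
      (((1 + (2 * π * ‖ξ‖) ^ 2) ^ (-s / 2) : ℝ) : ℂ) := by
  have hG := Gamma_pos_of_pos (half_pos hs)
  have hint := integrable_besselDensity (V := V) hs
  have h1 : 𝓕 (fun x : V ↦ (besselKernel s x : ℂ)) ξ =
      ∫ x, ∫ t in Ioi 0, 𝐞 (-inner ℝ x ξ) • (besselDensity s t x : ℂ) := by
    rw [Real.fourier_eq]
    refine integral_congr_ae (ae_of_all _ fun x ↦ ?_)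
    simp only [besselKernel]
    rw [← integral_complex_ofReal, Circle.smul_def, smul_eq_mul, ← integral_const_mul]
    simp only [Circle.smul_def, smul_eq_mul]
  rw [h1, integral_integral_swap]
  · have h2 : ∀ t ∈ Ioi (0 : ℝ), ∫ x : V, 𝐞 (-inner ℝ x ξ) • (besselDensity s t x : ℂ) =
        (((Gamma (s / 2))⁻¹ * (t ^ (s / 2 - 1) *
          exp (-((1 + (2 * π * ‖ξ‖) ^ 2) * t))) : ℝ) : ℂ) := by
      intro t ht
      have ht' : 0 < t := ht
      have hF := fourier_gaussian_innerProductSpace (V := V) (b := (((4 * t)⁻¹ : ℝ) : ℂ))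
        (by rw [Complex.ofReal_re]; positivity) ξ
      rw [Real.fourier_eq] at hF
      have h3 : ∀ x : V, 𝐞 (-inner ℝ x ξ) • (besselDensity s t x : ℂ) =
          (((Gamma (s / 2))⁻¹ * (t ^ (s / 2 - 1) * exp (-t)) *
            (4 * π * t) ^ (-(finrank ℝ V / 2 : ℝ)) : ℝ) : ℂ) *
          (𝐞 (-inner ℝ x ξ) • Complex.exp (-(((4 * t)⁻¹ : ℝ) : ℂ) * ‖x‖ ^ 2)) := by
        intro x
        rw [Circle.smul_def, Circle.smul_def, smul_eq_mul, smul_eq_mul, besselDensity]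
        push_cast
        ring
      simp_rw [h3]
      have e1 : (π : ℂ) / (((4 * t)⁻¹ : ℝ) : ℂ) = ((4 * π * t : ℝ) : ℂ) := by
        push_cast; field_simp
      have e2 : ((4 * π * t : ℝ) : ℂ) ^ (finrank ℝ V / 2 : ℂ) =
          (((4 * π * t) ^ (finrank ℝ V / 2 : ℝ) : ℝ) : ℂ) := by
        rw [Complex.ofReal_cpow (by positivity)]
        push_cast
        rfl
      have e3 : Complex.exp (-π ^ 2 * ‖ξ‖ ^ 2 / (((4 * t)⁻¹ : ℝ) : ℂ)) =
          ((exp (-((2 * π * ‖ξ‖) ^ 2 * t)) : ℝ) : ℂ) := by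
        push_cast
        congr 1
        field_simp
        ring
      have e4 : exp (-((1 + (2 * π * ‖ξ‖) ^ 2) * t)) =
          exp (-t) * exp (-((2 * π * ‖ξ‖) ^ 2 * t)) := by
        rw [← exp_add]; ring_nf
      have e5 : (4 * π * t) ^ (-(finrank ℝ V / 2 : ℝ)) *
          (4 * π * t) ^ (finrank ℝ V / 2 : ℝ) = 1 := by
        rw [← rpow_add (by positivity), neg_add_cancel, rpow_zero]
      rw [integral_const_mul, hF, e1, e2, e3, e4, ← Complex.ofReal_mul, ← Complex.ofReal_mul]
      congr 1
      linear_combination ((Gamma (s / 2))⁻¹ * (t ^ (s / 2 - 1) * exp (-t)) *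
        exp (-((2 * π * ‖ξ‖) ^ 2 * t))) * e5
    rw [setIntegral_congr_fun measurableSet_Ioi h2, integral_complex_ofReal, integral_const_mul,
      integral_rpow_mul_exp_neg_mul_Ioi (half_pos hs) (by positivity)]
    congr 1
    rw [one_div, inv_rpow (by positivity), ← rpow_neg (by positivity)]
    field_simp
  · have : Integrable (fun z : V × ℝ ↦ (besselDensity s z.2 z.1 : ℂ))
      (volume.prod (volume.restrict (Ioi 0))) := hint.ofReal
    refine this.norm.mono' ?_ ?_
    · have : Continuous fun z : V × ℝ ↦ 𝐞 (-inner ℝ z.1 ξ) :=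
        Real.continuous_fourierChar.comp (by fun_prop)
      exact this.aestronglyMeasurable.smul hint.ofReal.aestronglyMeasurable
    · exact ae_of_all _ fun z ↦ by simp [Function.uncurry]

end BesselKernel

/-! ### Inverting the operator by convolution with the kernel -/

section Representation

open FourierTransform

/-- The transpose of `(1 - Δ)^{-s/2}`, in the form in which it arises from the Fourier multipliers
of tempered distributions, acts on Schwartz functions by correlation with the Bessel kernel. -/
theorem schwartz_fourierMultiplier_besselSymbol_neg (n : ℕ) {s : ℝ} (hs : 0 < s)
    (ψ : 𝓢(EuclideanSpace ℝ (Fin n), ℂ)) (x : EuclideanSpace ℝ (Fin n)) :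
    𝓕 (SchwartzMap.smulLeftCLM ℂ (fun ξ ↦ (besselSymbol n (-s) ξ : ℂ)) (𝓕⁻ ψ)) x =
      ∫ y, (besselKernel s y : ℂ) * ψ (x + y) := by
  set Φ := SchwartzMap.smulLeftCLM ℂ (fun ξ ↦ (besselSymbol n (-s) ξ : ℂ)) (𝓕⁻ ψ) with hΦ
  set G : EuclideanSpace ℝ (Fin n) → ℂ := fun y ↦ (besselKernel s y : ℂ)
  -- the reflection turns the inverse transform of `ψ` into a direct one
  set g : EuclideanSpace ℝ (Fin n) → ℂ := fun y ↦ ψ (-y)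
  have hG : Integrable G := integrable_besselKernel hs
  have hg : Integrable g := ψ.integrable.comp_neg
  have hgc : Continuous g := ψ.continuous.comp continuous_neg
  obtain ⟨M, hM⟩ : ∃ M, ∀ y, ‖ψ y‖ ≤ M := by
    refine ⟨SchwartzMap.seminorm ℝ 0 0 ψ, fun y ↦ SchwartzMap.norm_le_seminorm ℝ ψ y⟩
  set h := convolution G g (ContinuousLinearMap.mul ℂ ℂ) volume with hh
  have hF : 𝓕 h = Φ := by
    ext ξ
    rw [hh, Real.fourier_mul_convolution_eq hG hg, fourier_besselKernel hs, hΦ,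
      SchwartzMap.smulLeftCLM_apply_apply (besselSymbol_hasTemperateGrowth n (-s)),
      SchwartzMap.fourierInv_coe, Real.fourierInv_eq_fourier_comp_neg]
    rfl
  have hhc : Continuous h := by
    refine BddAbove.continuous_convolution_right_of_integrable _ ?_ hG hgc
    exact ⟨M, by rintro _ ⟨y, rfl⟩; exact hM _⟩
  have hinv : 𝓕⁻ (𝓕 h) = h :=
    hhc.fourierInv_fourier_eq (hG.integrable_convolution _ hg) (hF ▸ Φ.integrable)
  rw [SchwartzMap.fourier_coe]
  calc 𝓕 (Φ : EuclideanSpace ℝ (Fin n) → ℂ) x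
      = 𝓕⁻ (Φ : EuclideanSpace ℝ (Fin n) → ℂ) (-x) := by
        rw [Real.fourierInv_eq_fourier_neg, neg_neg]
    _ = h (-x) := by rw [← hF, hinv]
    _ = _ := by
        simp only [hh, convolution_def, G, g, ContinuousLinearMap.mul_apply']
        congr 1
        ext y
        congr 2
        abel

/-- If `(1 - Δ)^{s/2} u = f`, then testing `u` against `ψ` amounts to testing `f` against
`(1 - Δ)^{-s/2} ψ`: the symbols of order `s` and `-s` are inverse to each other on Schwartz
space. -/
theorem integral_smul_eq_of_besselOp_eq {n : ℕ} {s : ℝ} (hs : 0 < s) {p q : ℝ≥0∞}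
    [Fact (1 ≤ p)] [Fact (1 ≤ q)] {u : Lp ℂ q (volume : Measure (EuclideanSpace ℝ (Fin n)))}
    {f : Lp ℂ p (volume : Measure (EuclideanSpace ℝ (Fin n)))}
    (huf : besselOp n s (u : 𝓢'(EuclideanSpace ℝ (Fin n), ℂ)) =
      (f : 𝓢'(EuclideanSpace ℝ (Fin n), ℂ))) (ψ : 𝓢(EuclideanSpace ℝ (Fin n), ℂ)) :
    ∫ z, ψ z * u z = ∫ x, (∫ y, (besselKernel s y : ℂ) * ψ (x + y)) * f x := by
  have h1 := besselSymbol_hasTemperateGrowth n s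
  have h2 := besselSymbol_hasTemperateGrowth n (-s)
  set φ := 𝓕 (SchwartzMap.smulLeftCLM ℂ (fun ξ ↦ (besselSymbol n (-s) ξ : ℂ)) (𝓕⁻ ψ)) with hφ
  have key := DFunLike.congr_fun huf φ
  have h3 : ((fun ξ ↦ (besselSymbol n s ξ : ℂ)) * fun ξ ↦ (besselSymbol n (-s) ξ : ℂ)) =
      fun _ ↦ 1 := by
    ext ξ
    simp only [Pi.mul_apply, besselSymbol]
    rw [← Complex.ofReal_mul, ← Real.rpow_add (by positivity)]
    simp [neg_div]
  rw [besselOp, fourierMultiplierCLM_apply_apply, hφ, FourierTransform.fourierInv_fourier_eq,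
    SchwartzMap.smulLeftCLM_smulLeftCLM_apply h1 h2, h3, SchwartzMap.smulLeftCLM_const, one_smul,
    ContinuousLinearMap.id_apply, FourierTransform.fourier_fourierInv_eq,
    Lp.toTemperedDistribution_apply, Lp.toTemperedDistribution_apply] at key
  simp only [smul_eq_mul] at key
  rw [key]
  simp only [schwartz_fourierMultiplier_besselSymbol_neg n hs ψ]

/-- Fubini's theorem for the pairing of a convolution `G * f` with a continuous compactly
supported function. Absolute convergence holds because `|G| * |f|` is in some `L^q`, hence
integrable on the support of `ψ`. -/
theorem integral_mul_swap_of_eLpNorm_lconvolution_lt_top {V : Type*} [NormedAddCommGroup V]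
    [MeasurableSpace V] [BorelSpace V] [SecondCountableTopology V] {μ : Measure V} [SFinite μ]
    [IsFiniteMeasureOnCompacts μ] [μ.IsAddLeftInvariant] {q : ℝ≥0∞} (hq : 1 ≤ q)
    {f G ψ : V → ℂ} (hf : Measurable f) (hG : Measurable G) (hψ : Continuous ψ)
    (hψc : HasCompactSupport ψ)
    (hfG : eLpNorm (fun x ↦ ∫⁻ y, ‖G (x - y)‖ₑ * ‖f y‖ₑ ∂μ) q μ < ⊤) :
    ∫ x, (∫ y, G y * ψ (x + y) ∂μ) * f x ∂μ = ∫ z, ψ z * ∫ x, G (z - x) * f x ∂μ ∂μ := by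
  have h1 : ∀ x, ∫ y, G y * ψ (x + y) ∂μ = ∫ z, G (z - x) * ψ z ∂μ := by
    intro x
    rw [← integral_add_left_eq_self (fun z ↦ G (z - x) * ψ z) x]
    simp only [add_sub_cancel_left]
  simp_rw [h1, ← integral_mul_const, ← integral_const_mul]
  rw [integral_integral_swap]
  · congr 1; ext z; congr 1; ext x; ring
  have hm : Measurable (Function.uncurry fun x z ↦ G (z - x) * ψ z * f x) := by
    have := hψ.measurable
    unfold Function.uncurry
    fun_prop
  refine ⟨hm.aestronglyMeasurable, ?_⟩
  obtain ⟨M, hM⟩ := hψc.exists_bound_of_continuous hψ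
  set L : V → ℝ≥0∞ := fun x ↦ ∫⁻ y, ‖G (x - y)‖ₑ * ‖f y‖ₑ ∂μ
  have hLm : Measurable L := by
    have : Measurable fun z : V × V ↦ ‖G (z.1 - z.2)‖ₑ * ‖f z.2‖ₑ := by fun_prop
    exact this.lintegral_prod_right'
  rw [hasFiniteIntegral_iff_enorm, lintegral_prod_symm _ hm.enorm.aemeasurable]
  have h2 : ∀ z, ∫⁻ x, ‖Function.uncurry (fun x z ↦ G (z - x) * ψ z * f x) (x, z)‖ₑ ∂μ =
      ‖ψ z‖ₑ * L z := by
    intro z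
    simp only [Function.uncurry, enorm_mul, L]
    rw [← lintegral_const_mul _ (by fun_prop)]
    congr 1; ext x; ring
  simp_rw [h2]
  have h3 : ∀ z, ‖ψ z‖ₑ * L z ≤ (tsupport ψ).indicator (fun z ↦ ENNReal.ofReal M * L z) z := by
    intro z
    by_cases hz : z ∈ tsupport ψ
    · rw [Set.indicator_of_mem hz]
      gcongr
      rw [← ofReal_norm]
      exact ENNReal.ofReal_le_ofReal (hM z)
    · simp [image_eq_zero_of_notMem_tsupport hz]
  refine (lintegral_mono h3).trans_lt ?_
  rw [lintegral_indicator (isClosed_tsupport ψ).measurableSet, lintegral_const_mul _ hLm]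
  refine ENNReal.mul_lt_top ENNReal.ofReal_lt_top ?_
  have hfin : μ (tsupport ψ) < ⊤ := hψc.isCompact.measure_lt_top
  have h4 := eLpNorm_le_eLpNorm_mul_rpow_measure_univ (μ := μ.restrict (tsupport ψ)) hq
    (f := L) hLm.aestronglyMeasurable
  rw [eLpNorm_one_eq_lintegral_enorm] at h4
  simp only [enorm_eq_self] at h4
  refine h4.trans_lt (ENNReal.mul_lt_top ?_ ?_)
  · exact (eLpNorm_mono_measure _ Measure.restrict_le_self).trans_lt hfG
  · rw [Measure.restrict_apply_univ]
    refine ENNReal.rpow_lt_top_of_nonneg ?_ hfin.ne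
    rw [sub_nonneg, ENNReal.toReal_one]
    rcases eq_or_ne q ⊤ with rfl | hqt
    · simp
    · have := (ENNReal.toReal_le_toReal ENNReal.one_ne_top hqt).2 hq
      rw [ENNReal.toReal_one] at this
      rw [div_one, div_le_one (by linarith)]
      exact this

theorem memLp_integral_of_eLpNorm_lconvolution_lt_top {V : Type*} [NormedAddCommGroup V]
    [MeasurableSpace V] [BorelSpace V] [SecondCountableTopology V] {μ : Measure V} [SFinite μ]
    {q : ℝ≥0∞} {f G : V → ℂ} (hf : Measurable f) (hG : Measurable G)
    (hfG : eLpNorm (fun x ↦ ∫⁻ y, ‖G (x - y)‖ₑ * ‖f y‖ₑ ∂μ) q μ < ⊤) :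
    MemLp (fun x ↦ ∫ y, G (x - y) * f y ∂μ) q μ := by
  have hm : Measurable fun z : V × V ↦ G (z.1 - z.2) * f z.2 := by fun_prop
  refine ⟨(hm.stronglyMeasurable.integral_prod_right' (ν := μ)).aestronglyMeasurable, ?_⟩
  refine (eLpNorm_mono_enorm fun x ↦ ?_).trans_lt hfG
  rw [enorm_eq_self]
  refine (enorm_integral_le_lintegral_enorm _).trans_eq ?_
  simp only [enorm_mul]

/-- The representation `u = G_s * f` of a solution of `(1 - Δ)^{s/2} u = f`. The exponent `q'` of
the convolution need not be that of `u`: local integrability of both sides suffices to compare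
them. -/
theorem ae_eq_besselKernel_convolution {n : ℕ} {s : ℝ} (hs : 0 < s) {p q q' : ℝ≥0∞}
    [Fact (1 ≤ p)] [Fact (1 ≤ q)] (hq' : 1 ≤ q')
    {u : Lp ℂ q (volume : Measure (EuclideanSpace ℝ (Fin n)))}
    {f : Lp ℂ p (volume : Measure (EuclideanSpace ℝ (Fin n)))}
    (huf : besselOp n s (u : 𝓢'(EuclideanSpace ℝ (Fin n), ℂ)) =
      (f : 𝓢'(EuclideanSpace ℝ (Fin n), ℂ)))
    (hfin : eLpNorm (fun x ↦ ∫⁻ y, ‖(besselKernel s (x - y) : ℂ)‖ₑ * ‖f y‖ₑ) q' < ⊤) :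
    (u : EuclideanSpace ℝ (Fin n) → ℂ) =ᵐ[volume]
      fun x ↦ ∫ y, (besselKernel s (x - y) : ℂ) * f y := by
  have hfm : Measurable (f : EuclideanSpace ℝ (Fin n) → ℂ) := (Lp.stronglyMeasurable f).measurable
  have hGm : Measurable fun x : EuclideanSpace ℝ (Fin n) ↦ (besselKernel s x : ℂ) :=
    Complex.measurable_ofReal.comp (measurable_besselKernel s)
  refine ae_eq_of_integral_contDiff_smul_eq ((Lp.memLp u).locallyIntegrable Fact.out)
    ((memLp_integral_of_eLpNorm_lconvolution_lt_top hfm hGm hfin).locallyIntegrable hq') ?_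
  intro g g_smooth g_cpt
  have hg₁ : HasCompactSupport (Complex.ofRealCLM ∘ g) := g_cpt.comp_left rfl
  have hg₂ : ContDiff ℝ ∞ (Complex.ofRealCLM ∘ g) := by fun_prop
  have h1 := integral_smul_eq_of_besselOp_eq hs huf (hg₁.toSchwartzMap hg₂)
  have h2 := integral_mul_swap_of_eLpNorm_lconvolution_lt_top hq' hfm hGm hg₂.continuous hg₁ hfin
  have h3 := h1.trans h2
  simpa using h3

end Representation

/-! ### Compactness of convolution operators on bounded sets -/

section Compactness

open scoped Pointwise

/-- The Arzelà–Ascoli theorem for a sequence of functions on a compact set, as the existence of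
finite uniform nets consisting of members of the sequence. -/
theorem exists_finite_net_of_uniform_equicontinuous {X : Type*} [PseudoMetricSpace X] {K : Set X}
    (hK : IsCompact K) {a : ℕ → X → ℂ} {M : ℝ} (hM : ∀ m, ∀ x ∈ K, ‖a m x‖ ≤ M)
    (ha : ∀ ε > 0, ∃ δ > 0, ∀ m, ∀ x ∈ K, ∀ y ∈ K, dist x y < δ → dist (a m x) (a m y) < ε)
    {ε : ℝ} (hε : 0 < ε) :
    ∃ t : Set ℕ, t.Finite ∧ ∀ m, ∃ i ∈ t, ∀ x ∈ K, dist (a m x) (a i x) ≤ ε := by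
  have : CompactSpace K := isCompact_iff_compactSpace.1 hK
  have hc : ∀ m, Continuous fun x : K ↦ a m x := by
    intro m
    rw [Metric.continuous_iff]
    intro x η hη
    obtain ⟨δ, hδ, h⟩ := ha η hη
    exact ⟨δ, hδ, fun y hy ↦ h m y y.2 x x.2 hy⟩
  set F : ℕ → BoundedContinuousFunction K ℂ := fun m ↦
    BoundedContinuousFunction.mkOfCompact ⟨fun x : K ↦ a m x, hc m⟩ with hF
  have hcomp : IsCompact (closure (Set.range F)) := by
    refine BoundedContinuousFunction.arzela_ascoli (Metric.closedBall 0 M)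
      (isCompact_closedBall 0 M) _ ?_ ?_
    · rintro _ x ⟨m, rfl⟩
      simpa [hF] using hM m x x.2
    · intro x
      rw [Metric.equicontinuousAt_iff]
      intro η hη
      obtain ⟨δ, hδ, h⟩ := ha η hη
      refine ⟨δ, hδ, ?_⟩
      rintro y hy ⟨_, m, rfl⟩
      exact h m x x.2 y y.2 (by rwa [dist_comm] at hy)
  have htb : TotallyBounded (Set.range F) := hcomp.totallyBounded.subset subset_closure
  obtain ⟨T, hTs, hTf, hT⟩ := Metric.finite_approx_of_totallyBounded htb ε hε
  have hTs' : ∀ y ∈ T, ∃ i, F i = y := fun y hy ↦ hTs hy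
  choose! j hj using hTs'
  refine ⟨j '' T, hTf.image j, fun m ↦ ?_⟩
  obtain ⟨y, hyT, hy⟩ := Set.mem_iUnion₂.1 (hT ⟨m, rfl⟩)
  refine ⟨j y, ⟨y, hyT, rfl⟩, fun x hx ↦ ?_⟩
  have h1 := BoundedContinuousFunction.dist_coe_le_dist (f := F m) (g := F (j y)) ⟨x, hx⟩
  have h2 : dist (F m) (F (j y)) < ε := by rw [hj y hyT]; exact hy
  exact h1.trans h2.le

variable {V : Type*} [NormedAddCommGroup V] [InnerProductSpace ℝ V] [FiniteDimensional ℝ V]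
  [MeasurableSpace V] [BorelSpace V]

/-- Convolution with a continuous compactly supported kernel maps `L^p`-bounded sequences to
sequences that are totally bounded for uniform convergence on a compact set `K`. On `K` only the
values of `f m` on `K - tsupport g` matter, and there its `L¹` norm is controlled. -/
theorem exists_finite_net_convolution_of_hasCompactSupport {p : ℝ≥0∞} (hp : 1 ≤ p)
    {g : V → ℂ} (hg : Continuous g) (hgc : HasCompactSupport g) {f : ℕ → V → ℂ}
    (hf : ∀ m, Measurable (f m)) {C : ℝ≥0∞} (hC : C ≠ ⊤) (hfC : ∀ m, eLpNorm (f m) p volume ≤ C)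
    {K : Set V} (hK : IsCompact K) {ε : ℝ} (hε : 0 < ε) :
    ∃ t : Set ℕ, t.Finite ∧ ∀ m, ∃ i ∈ t, ∀ x ∈ K,
      dist (∫ y, g (x - y) * f m y) (∫ y, g (x - y) * f i y) ≤ ε := by
  set B : Set V := K - tsupport g with hB
  have hBc : IsCompact B := by
    have := (hK.prod hgc.isCompact).image (continuous_fst.sub continuous_snd)
    rw [hB, ← Set.sub_image_prod]
    exact this
  obtain ⟨D, hD⟩ : ∃ D : ℝ, ∀ m, IntegrableOn (f m) B ∧ ∫ y in B, ‖f m y‖ ≤ D := by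
    have hBfin : volume B < ⊤ := hBc.measure_lt_top
    set c := volume B ^ (1 / (1 : ℝ≥0∞).toReal - 1 / p.toReal)
    have hct : c ≠ ⊤ := by
      refine ENNReal.rpow_ne_top_of_nonneg ?_ hBfin.ne
      rw [sub_nonneg, ENNReal.toReal_one]
      rcases eq_or_ne p ⊤ with rfl | hpt
      · simp
      · have := (ENNReal.toReal_le_toReal ENNReal.one_ne_top hpt).2 hp
        rw [ENNReal.toReal_one] at this
        rw [div_one, div_le_one (by linarith)]
        exact this
    refine ⟨(C * c).toReal, fun m ↦ ?_⟩
    have h1 : ∫⁻ y in B, ‖f m y‖ₑ ≤ C * c := by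
      have := eLpNorm_le_eLpNorm_mul_rpow_measure_univ (μ := volume.restrict B) hp
        (hf m).aestronglyMeasurable
      rw [eLpNorm_one_eq_lintegral_enorm, Measure.restrict_apply_univ] at this
      exact this.trans (mul_le_mul_left ((eLpNorm_mono_measure _ Measure.restrict_le_self).trans
        (hfC m)) _)
    have hfin : C * c ≠ ⊤ := ENNReal.mul_ne_top hC hct
    refine ⟨⟨(hf m).aestronglyMeasurable, h1.trans_lt hfin.lt_top⟩, ?_⟩
    rw [integral_norm_eq_lintegral_enorm (hf m).aestronglyMeasurable]
    exact ENNReal.toReal_mono hfin h1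
  have hD0 : 0 ≤ D := (integral_nonneg fun _ ↦ norm_nonneg _).trans (hD 0).2
  obtain ⟨M, hM⟩ := hgc.exists_bound_of_continuous hg
  have hset : ∀ m, ∀ x ∈ K, ∫ y, g (x - y) * f m y = ∫ y in B, g (x - y) * f m y := by
    intro m x hx
    refine (setIntegral_eq_integral_of_forall_compl_eq_zero fun y hy ↦ ?_).symm
    have : x - y ∉ tsupport g := fun h ↦ hy (by
      rw [hB]; exact ⟨x, hx, x - y, h, by simp⟩)
    rw [image_eq_zero_of_notMem_tsupport this, zero_mul]
  have hint : ∀ m x, IntegrableOn (fun y ↦ g (x - y) * f m y) B := by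
    intro m x
    refine (hD m).1.bdd_mul (c := M) ?_ (ae_of_all _ fun y ↦ hM _)
    exact (hg.comp (by fun_prop)).aestronglyMeasurable
  refine exists_finite_net_of_uniform_equicontinuous (M := M * D) hK ?_ ?_ hε
  · intro m x hx
    rw [hset m x hx]
    calc ‖∫ y in B, g (x - y) * f m y‖ ≤ ∫ y in B, M * ‖f m y‖ := by
          refine norm_integral_le_of_norm_le ((hD m).1.norm.const_mul M) (ae_of_all _ fun y ↦ ?_)
          rw [norm_mul]
          exact mul_le_mul_of_nonneg_right (hM _) (norm_nonneg _)
      _ ≤ M * D := by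
          rw [integral_const_mul]
          exact mul_le_mul_of_nonneg_left (hD m).2 ((norm_nonneg _).trans (hM 0))
  · intro η hη
    have hη' : 0 < η / (D + 1) := by positivity
    obtain ⟨δ, hδ, h⟩ := Metric.uniformContinuous_iff.1 (hgc.uniformContinuous_of_continuous hg)
      (η / (D + 1)) hη'
    refine ⟨δ, hδ, fun m x hx x' hx' hxx ↦ ?_⟩
    rw [hset m x hx, hset m x' hx', dist_eq_norm, ← integral_sub (hint m x) (hint m x')]
    calc ‖∫ y in B, (g (x - y) * f m y - g (x' - y) * f m y)‖
        ≤ ∫ y in B, (η / (D + 1)) * ‖f m y‖ := by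
          refine norm_integral_le_of_norm_le ((hD m).1.norm.const_mul _) (ae_of_all _ fun y ↦ ?_)
          rw [← sub_mul, norm_mul, ← dist_eq_norm]
          refine mul_le_mul_of_nonneg_right (h ?_).le (norm_nonneg _)
          simpa using hxx
      _ ≤ (η / (D + 1)) * D := by
          rw [integral_const_mul]
          exact mul_le_mul_of_nonneg_left (hD m).2 hη'.le
      _ < η := by
          rw [div_mul_eq_mul_div, div_lt_iff₀ (by positivity)]
          nlinarith

theorem ae_integrable_of_eLpNorm_lconvolution_lt_top {q : ℝ} (hq : 0 < q) {f G : V → ℂ}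
    (hf : Measurable f) (hG : Measurable G)
    (hfG : eLpNorm (fun x ↦ ∫⁻ y, ‖G (x - y)‖ₑ * ‖f y‖ₑ) (ENNReal.ofReal q) volume < ⊤) :
    ∀ᵐ x, Integrable fun y ↦ G (x - y) * f y := by
  have hm : Measurable fun z : V × V ↦ ‖G (z.1 - z.2)‖ₑ * ‖f z.2‖ₑ := by fun_prop
  rw [eLpNorm_lt_top_iff_lintegral_rpow_enorm_lt_top (by simpa using hq) ENNReal.ofReal_ne_top,
    ENNReal.toReal_ofReal hq.le] at hfG
  filter_upwards [ae_lt_top (by exact (hm.lintegral_prod_right' (ν := volume)).enorm.pow_const q)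
    hfG.ne] with x hx
  refine ⟨by fun_prop, ?_⟩
  rw [enorm_eq_self, ENNReal.rpow_lt_top_iff_of_pos hq] at hx
  simpa only [hasFiniteIntegral_iff_enorm, enorm_mul] using hx

theorem ENNReal.exists_pos_ofReal_mul_le {a e : ℝ≥0∞} (ha : a ≠ ⊤) (he : e ≠ 0) (he' : e ≠ ⊤) :
    ∃ b : ℝ, 0 < b ∧ ENNReal.ofReal b * a ≤ e := by
  have h1 : a + 1 ≠ ⊤ := ENNReal.add_ne_top.2 ⟨ha, ENNReal.one_ne_top⟩
  have h0 : a + 1 ≠ 0 := by simp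
  have h2 : e / (a + 1) ≠ ⊤ := ENNReal.div_ne_top he' h0
  refine ⟨(e / (a + 1)).toReal, ENNReal.toReal_pos (ENNReal.div_ne_zero.2 ⟨he, h1⟩) h2, ?_⟩
  rw [ENNReal.ofReal_toReal h2]
  calc e / (a + 1) * a ≤ e / (a + 1) * (a + 1) := by gcongr; exact le_self_add
    _ = e := ENNReal.div_mul_cancel h0 h1

/-- Convolution with a kernel in `L^r` is compact from `L^p` to `L^q` of a bounded set, if `p`, `q`,
`r` satisfy Young's relation. -/
theorem exists_subseq_tendsto_convolution {p q r : ℝ} (hp : 1 ≤ p) (hq : 1 ≤ q) (hr : 1 ≤ r)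
    (hpqr : 1 / p + 1 / r = 1 + 1 / q) {G : V → ℂ} (hGm : Measurable G)
    (hG : MemLp G (ENNReal.ofReal r) volume) {f : ℕ → V → ℂ}
    (hf : ∀ m, Measurable (f m)) {C : ℝ≥0∞} (hC : C ≠ ⊤)
    (hfC : ∀ m, eLpNorm (f m) (ENNReal.ofReal p) volume ≤ C)
    {Ω : Set V} (hΩ : Bornology.IsBounded Ω) :
    ∃ φ : ℕ → ℕ, StrictMono φ ∧ ∃ v : V → ℂ,
      MemLp v (ENNReal.ofReal q) (volume.restrict Ω) ∧
        Tendsto (fun k ↦ eLpNorm (fun x ↦ (∫ y, G (x - y) * f (φ k) y) - v x)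
          (ENNReal.ofReal q) (volume.restrict Ω)) atTop (𝓝 0) := by
  have hq0 : 0 < q := by linarith
  have hq1 : 1 ≤ ENNReal.ofReal q := by simpa using hq
  have hp1 : 1 ≤ ENNReal.ofReal p := by simpa using hp
  have : Fact (1 ≤ ENNReal.ofReal q) := ⟨hq1⟩
  -- Young's inequality for a kernel `H` in `L^r`
  have young : ∀ (H : V → ℂ), Measurable H → ∀ m,
      eLpNorm (fun x ↦ ∫⁻ y, ‖H (x - y)‖ₑ * ‖f m y‖ₑ) (ENNReal.ofReal q) volume ≤
        eLpNorm H (ENNReal.ofReal r) volume * C := fun H hH m ↦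
    (eLpNorm_lconvolution_le hp hq0 hr hpqr (hf m) hH).trans (mul_le_mul_right (hfC m) _)
  have hmem : ∀ (H : V → ℂ), Measurable H → MemLp H (ENNReal.ofReal r) volume → ∀ m,
      MemLp (fun x ↦ ∫ y, H (x - y) * f m y) (ENNReal.ofReal q) volume := fun H hH hHr m ↦
    memLp_integral_of_eLpNorm_lconvolution_lt_top (hf m) hH
      ((young H hH m).trans_lt (ENNReal.mul_lt_top hHr.2 hC.lt_top))
  set μ := volume.restrict Ω with hμ
  have hmemΩ := fun m ↦ (hmem G hGm hG m).restrict Ω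
  set F : ℕ → Lp ℂ (ENNReal.ofReal q) μ := fun m ↦ (hmemΩ m).toLp with hF
  have htb : TotallyBounded (Set.range F) := by
    rw [EMetric.totallyBounded_iff]
    intro ε hε
    -- the radius `ε` may be infinite, so that it is first replaced by a finite one
    obtain ⟨e, he0, heε⟩ := exists_between (lt_min hε zero_lt_one : 0 < min ε 1)
    have heε' : e < ε := heε.trans_le (min_le_left _ _)
    have het : e ≠ ⊤ := (heε.trans_le (min_le_right _ _)).ne_top.trans_eq rfl
    have h3 : e / 3 ≠ 0 := ENNReal.div_ne_zero.2 ⟨he0.ne', by simp⟩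
    have h3t : e / 3 ≠ ⊤ := ENNReal.div_ne_top het (by simp)
    obtain ⟨η, hη, hηC⟩ := ENNReal.exists_pos_ofReal_mul_le hC h3 h3t
    obtain ⟨H, hHc, hGH, hHcont, hHr⟩ := hG.exists_hasCompactSupport_eLpNorm_sub_le
      ENNReal.ofReal_ne_top (ε := ENNReal.ofReal η) (by simpa using hη)
    have hHm := hHcont.measurable
    have hμfin : μ Set.univ < ⊤ := by
      rw [hμ, Measure.restrict_apply_univ]
      exact hΩ.measure_lt_top
    have hκ : μ Set.univ ^ q⁻¹ ≠ ⊤ :=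
      ENNReal.rpow_ne_top_of_nonneg (by positivity) hμfin.ne
    obtain ⟨δ, hδ, hδκ⟩ := ENNReal.exists_pos_ofReal_mul_le hκ h3 h3t
    obtain ⟨t, htf, ht⟩ := exists_finite_net_convolution_of_hasCompactSupport hp1 hHcont hHc hf hC
      hfC hΩ.isCompact_closure hδ
    refine ⟨F '' t, htf.image F, ?_⟩
    rintro _ ⟨m, rfl⟩
    obtain ⟨i, hit, hi⟩ := ht m
    refine Set.mem_iUnion₂.2 ⟨F i, ⟨i, hit, rfl⟩, ?_⟩
    set Gf : ℕ → V → ℂ := fun m x ↦ ∫ y, G (x - y) * f m y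
    set Hf : ℕ → V → ℂ := fun m x ↦ ∫ y, H (x - y) * f m y
    have hHmem := fun m ↦ (hmem H hHm hHr m).restrict Ω
    have happ : ∀ m, eLpNorm (Gf m - Hf m) (ENNReal.ofReal q) μ ≤ e / 3 := by
      intro m
      have hsub : Measurable (G - H) := hGm.sub hHm
      refine (eLpNorm_mono_measure _ Measure.restrict_le_self).trans
        (le_trans ?_ ((young (G - H) hsub m).trans ((mul_le_mul_left hGH _).trans hηC)))
      refine eLpNorm_mono_enorm_ae ?_
      filter_upwards [ae_integrable_of_eLpNorm_lconvolution_lt_top hq0 (hf m) hGm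
        ((young G hGm m).trans_lt (ENNReal.mul_lt_top hG.2 hC.lt_top)),
        ae_integrable_of_eLpNorm_lconvolution_lt_top hq0 (hf m) hHm
        ((young H hHm m).trans_lt (ENNReal.mul_lt_top hHr.2 hC.lt_top))] with x hx1 hx2
      simp only [Pi.sub_apply, Gf, Hf, enorm_eq_self]
      rw [← integral_sub hx1 hx2]
      refine (enorm_integral_le_lintegral_enorm _).trans_eq ?_
      simp only [← sub_mul, enorm_mul]
    have hnet : eLpNorm (Hf m - Hf i) (ENNReal.ofReal q) μ ≤ e / 3 := by
      have h1 : ∀ᵐ x ∂μ, ‖(Hf m - Hf i) x‖ₑ ≤ ENNReal.ofReal δ := by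
        have hcl : ∀ᵐ x ∂μ, x ∈ closure Ω :=
          ae_mono (Measure.restrict_mono subset_closure le_rfl)
            (ae_restrict_mem isClosed_closure.measurableSet)
        filter_upwards [hcl] with x hx
        rw [← ofReal_norm, Pi.sub_apply, ← dist_eq_norm]
        exact ENNReal.ofReal_le_ofReal (hi x hx)
      have h2 := eLpNorm_le_of_ae_enorm_bound (p := ENNReal.ofReal q) h1
      rw [ENNReal.toReal_ofReal hq0.le, smul_eq_mul] at h2
      exact h2.trans hδκ
    rw [Metric.mem_eball, hF, Lp.edist_toLp_toLp]
    refine lt_of_le_of_lt ?_ heε'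
    have hdec : Gf m - Gf i = (Gf m - Hf m) + (Hf m - Hf i) - (Gf i - Hf i) := by abel
    change eLpNorm (Gf m - Gf i) _ _ ≤ _
    rw [hdec]
    have m1 := ((hmemΩ m).sub (hHmem m)).1
    have m2 := ((hHmem m).sub (hHmem i)).1
    have m3 := ((hmemΩ i).sub (hHmem i)).1
    calc _ ≤ _ := eLpNorm_sub_le (m1.add m2) m3 hq1
      _ ≤ (e / 3 + e / 3) + e / 3 :=
        add_le_add ((eLpNorm_add_le m1 m2 hq1).trans (add_le_add (happ m) hnet)) (happ i)
      _ = e := ENNReal.add_thirds e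
  obtain ⟨w, -, φ, hφ, hlim⟩ := (htb.closure.isCompact_of_isClosed
    isClosed_closure).tendsto_subseq
    (fun m ↦ subset_closure (Set.mem_range_self m))
  refine ⟨φ, hφ, w, Lp.memLp w, ?_⟩
  refine (tendsto_iff_edist_tendsto_0.1 hlim).congr fun k ↦ ?_
  rw [Lp.edist_def]
  refine eLpNorm_congr_ae ?_
  filter_upwards [(hmemΩ (φ k)).coeFn_toLp] with x hx
  simp only [Function.comp, Pi.sub_apply, hF, hx]

end Compactness

/-! ### Exponents and the compact embedding -/

/-- A subcritical exponent `q` can be enlarged to a subcritical `q₁ ≥ p`, and then Young's relation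
determines an exponent `r` for which the Bessel kernel is in `L^r`. -/
theorem exists_young_exponents {n s p q : ℝ} (hs : 0 < s) (hsn : s < n) (hp : 1 ≤ p)
    (hps : p < n / s) (hq : q < n * p / (n - s * p)) :
    ∃ q₁ r : ℝ, 1 ≤ q₁ ∧ q ≤ q₁ ∧ 1 ≤ r ∧ 1 / p + 1 / r = 1 + 1 / q₁ ∧ r * (n - s) < n := by
  have hp0 : 0 < p := by linarith
  have hn : 0 < n := hs.trans hsn
  have hsp : s * p < n := by rw [lt_div_iff₀ hs] at hps; linarith
  have hd : 0 < n - s * p := by linarith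
  -- `p` itself is subcritical, so that `max p q` is
  have hpp : p < n * p / (n - s * p) := by
    rw [lt_div_iff₀ hd]
    nlinarith [mul_pos hs (mul_pos hp0 hp0)]
  set q₁ := max p q
  have hq₁p : p ≤ q₁ := le_max_left _ _
  have hq₁ : q₁ < n * p / (n - s * p) := max_lt hpp hq
  have hq₁0 : 0 < q₁ := by linarith
  have h1 : 1 / q₁ ≤ 1 / p := one_div_le_one_div_of_le hp0 hq₁p
  have h2 : 1 / p - s / n < 1 / q₁ := by
    rw [lt_div_iff₀ hd] at hq₁
    rw [div_sub_div _ _ hp0.ne' hn.ne', div_lt_div_iff₀ (by positivity) hq₁0]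
    linarith
  have hsn' : s / n < 1 := (div_lt_one hn).2 hsn
  have hR : 0 < 1 + 1 / q₁ - 1 / p := by linarith
  refine ⟨q₁, 1 / (1 + 1 / q₁ - 1 / p), hp.trans hq₁p, le_max_right _ _, ?_, ?_, ?_⟩
  · rw [le_div_iff₀ hR]; linarith
  · rw [one_div_one_div]; ring
  · rw [one_div_mul_eq_div, div_lt_iff₀ hR]
    have : n * (s / n) = s := by field_simp
    nlinarith

theorem theorem2p5 (n : ℕ) (s : ℝ) (hs : 0 < s) (hsn : s < n)
    (p q : ℝ≥0∞) [Fact (1 ≤ p)] [Fact (1 ≤ q)]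
    (hp : p < ENNReal.ofReal (n / s))
    (hq : q < ENNReal.ofReal (n * p.toReal / (n - s * p.toReal)))
    (Ω : Set (EuclideanSpace ℝ (Fin n))) (hΩo : IsOpen Ω) (hΩb : Bornology.IsBounded Ω)
    (hΩs : HasSmoothBoundary Ω)
    (u : ℕ → Lp ℂ q (volume : Measure (EuclideanSpace ℝ (Fin n))))
    (hu : ∃ C : ℝ, ∀ m, ∃ f : Lp ℂ p (volume : Measure (EuclideanSpace ℝ (Fin n))),
      besselOp n s (u m : 𝓢'(EuclideanSpace ℝ (Fin n), ℂ)) =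
        (f : 𝓢'(EuclideanSpace ℝ (Fin n), ℂ)) ∧ ‖f‖ ≤ C) :
    ∃ φ : ℕ → ℕ, StrictMono φ ∧
      ∃ v : EuclideanSpace ℝ (Fin n) → ℂ, MemLp v q (volume.restrict Ω) ∧
        Tendsto (fun k ↦ eLpNorm (fun x ↦ u (φ k) x - v x) q (volume.restrict Ω))
          atTop (𝓝 0) := by
  have hpt : p ≠ ⊤ := hp.ne_top
  have hqt : q ≠ ⊤ := hq.ne_top
  have hp1 : 1 ≤ p.toReal := by
    simpa using ENNReal.toReal_mono hpt (Fact.out : 1 ≤ p)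
  have hpe : ENNReal.ofReal p.toReal = p := ENNReal.ofReal_toReal hpt
  obtain ⟨q₁, r, hq₁, hqq₁, hr, hpqr, hrs⟩ := exists_young_exponents hs hsn hp1
    ((ENNReal.lt_ofReal_iff_toReal_lt hpt).1 hp) ((ENNReal.lt_ofReal_iff_toReal_lt hqt).1 hq)
  have hqle : q ≤ ENNReal.ofReal q₁ := ENNReal.le_ofReal_iff_toReal_le hqt (by linarith) |>.2 hqq₁
  have hq₁0 : 0 < q₁ := by linarith
  obtain ⟨C, hC⟩ := hu
  choose f hf hfC using hC
  set G : EuclideanSpace ℝ (Fin n) → ℂ := fun x ↦ (besselKernel s x : ℂ)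
  have hGm : Measurable G := Complex.measurable_ofReal.comp (measurable_besselKernel s)
  have hG : MemLp G (ENNReal.ofReal r) volume :=
    memLp_besselKernel hs hr (by simpa using hrs)
  have hfm : ∀ m, Measurable (f m : EuclideanSpace ℝ (Fin n) → ℂ) := fun m ↦
    (Lp.stronglyMeasurable (f m)).measurable
  have hfC' : ∀ m, eLpNorm (f m) (ENNReal.ofReal p.toReal) volume ≤ ENNReal.ofReal C := by
    intro m
    rw [hpe, ← Lp.enorm_def, ← ofReal_norm]
    exact ENNReal.ofReal_le_ofReal (hfC m)
  have hrep : ∀ m, (u m : EuclideanSpace ℝ (Fin n) → ℂ) =ᵐ[volume]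
      fun x ↦ ∫ y, G (x - y) * f m y := by
    intro m
    refine ae_eq_besselKernel_convolution hs (q' := ENNReal.ofReal q₁) (by simpa using hq₁)
      (hf m) ?_
    exact (eLpNorm_lconvolution_le hp1 hq₁0 hr hpqr (hfm m) hGm).trans_lt
      (ENNReal.mul_lt_top hG.2 ((hfC' m).trans_lt ENNReal.ofReal_lt_top))
  obtain ⟨φ, hφ, v, hv, hlim⟩ := exists_subseq_tendsto_convolution hp1 hq₁ hr hpqr hGm hG hfm
    ENNReal.ofReal_ne_top hfC' hΩb
  have hΩfin : volume Ω < ⊤ := hΩb.measure_lt_top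
  have : IsFiniteMeasure (volume.restrict Ω) := ⟨by simpa using hΩfin⟩
  refine ⟨φ, hφ, v, hv.mono_exponent hqle, ?_⟩
  set c := (volume.restrict Ω) Set.univ ^ (1 / q.toReal - 1 / (ENNReal.ofReal q₁).toReal)
  have hc : c ≠ ⊤ := by
    refine ENNReal.rpow_ne_top_of_nonneg ?_ (measure_ne_top _ _)
    have : 1 ≤ q.toReal := by simpa using ENNReal.toReal_mono hqt (Fact.out : 1 ≤ q)
    rw [ENNReal.toReal_ofReal hq₁0.le, sub_nonneg]
    exact one_div_le_one_div_of_le (by linarith) hqq₁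
  have hlim' := ENNReal.Tendsto.mul_const (b := c) hlim (Or.inr hc)
  rw [zero_mul] at hlim'
  refine tendsto_of_tendsto_of_tendsto_of_le_of_le tendsto_const_nhds hlim' (fun _ ↦ zero_le)
    fun k ↦ ?_
  have hae : (fun x ↦ u (φ k) x - v x) =ᵐ[volume.restrict Ω]
      fun x ↦ (∫ y, G (x - y) * f (φ k) y) - v x := by
    filter_upwards [ae_restrict_of_ae (hrep (φ k))] with x hx
    rw [hx]
  simp only
  rw [← eLpNorm_congr_ae hae]
  exact eLpNorm_le_eLpNorm_mul_rpow_measure_univ hqle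
    ((Lp.aestronglyMeasurable (u (φ k))).restrict.sub hv.1)
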